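/- **Setting.** Let $D,M,K,d_e,L,W,S,n\ge 1$ be integers and $B>0$. Data are pairs $(\boldsymbol x,y)\in[M]^D\times[K]$. For an embedding $\phi\in\mathbb R^{d_e}$ of a source and shared parameters $\psi=(\boldsymbol V_X,\boldsymbol A_0,\boldsymbol b_0,\omega)$ with $\boldsymbol V_X\in\mathbb R^{M\times d_e}$, $\boldsymbol A_0\in\mathbb R^{D\times d_e}$, $\boldsymbol b_0\in\mathbb R^D$, let $\boldsymbol E(\boldsymbol x)\in\mathbb R^{D\times d_e}$ have first row $\phi$ and $d$-th row $\boldsymbol V_X[x_{d-1},:]$ for $d=2,\dots,D$. Let $\boldsymbol v(\boldsymbol x)\in\mathbb R^D$ have entries $v_d=\sigma(\boldsymbol A_0[d,:]\boldsymbol E(\boldsymbol x)[d,:]^\top+\boldsymbol b_0[d])$, where $\sigma(t)=1/(1+e^{-t})$. For $d\in[D]$ let $\boldsymbol v^{(d)}(\boldsymbol x)$ be $\boldsymbol v(\boldsymbol x)$ with all entries after the $d$-th replaced by $0$, and set $$p_{\phi,\psi}(\boldsymbol x)=\prod_{d=1}^D \mathrm{softmax}\big(\boldsymbol f_\omega(\boldsymbol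 v^{(d)}(\boldsymbol x))\big)[x_d],$$ where $\boldsymbol f_\omega(\boldsymbol u)=(\boldsymbol A^{(L)}\mathrm{ReLU}(\cdot)+\boldsymbol b^{(L)})\circ\cdots\circ(\boldsymbol A^{(1)}\boldsymbol u+\boldsymbol b^{(1)})$ with $\omega=\{(\boldsymbol A^{(l)},\boldsymbol b^{(l)})\}_{l=1}^L$, $\boldsymbol A^{(l)}\in\mathbb R^{W_l\times W_{l-1}}$, $\boldsymbol b^{(l)}\in\mathbb R^{W_l}$, $W_0=D$, $W_L=M$. Let $\mathcal W(L,W,S,B)$ be the set of all such $\omega$ with $\max_{1\le l\le L} W_l\le W$, with at most $S$ nonzero entries in total, and with all entries in $[-B,B]$. Let $$\Phi=[0,1]^{d_e},\qquad \Psi=[0,1]^{M\times d_e}\times[-B,B]^{D\times d_e}\times[-B,B]^D\times\mathcal W(L,W,S,B),$$ and let $\mathcal P^{\mathrm{multi}}$ be the set of conditional distributions $p(\boldsymbol x\mid k)=p_{\phi_k,\psi}(\boldsymbol x)$, $k\in[K]$, with $\phi_1,\dots,\phi_K\in\Phi$ and $\psi\in\Psi$ (one embedding per source, all other parameters shared).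 **Theorem.** There is a universal constant $C>0$ such that the following holds for all $D,M,K,d_e,L,W,S,n\ge1$, all $B>0$, all $0<\delta\le 1/2$, every distribution $p_Y$ on $[K]$ and every $p^*\in\mathcal P^{\mathrm{multi}}$. Let $(\boldsymbol x_i,y_i)_{i=1}^n$ be i.i.d. from the joint distribution $p^*(\boldsymbol x\mid y)\,p_Y(y)$. Then with probability at least $1-\delta$, every maximizer $\hat p^{\mathrm{multi}}$ of the conditional likelihood $p\mapsto\prod_{i=1}^n p(\boldsymbol x_i\mid y_i)$ over $\mathcal P^{\mathrm{multi}}$ satisfies $$\mathbb E_{Y\sim p_Y}\Big[\tfrac12\sum_{\boldsymbol x\in[M]^D}\big|\hat p^{\mathrm{multi}}(\boldsymbol x\mid Y)-p^*(\boldsymbol x\mid Y)\big|\Big]\le C\sqrt{\frac{L\big(S+D+(D+M+K)d_e\big)\,\log\!\big(n\,D\,d_e\,L\,(W+1)\,(B\vee1)\big)+\log\frac1\delta}{n}},$$ that is, the average total variation error is $\tilde{\mathcal O}\big(\sqrt{L(S+D+(D+M+K)d_e)/n}\big)$. -/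

import Mathlib

open MeasureTheory

noncomputable section

/-- Parameters of a multilayer perceptron, indexed by its depth, its input dimension and its output
dimension: `affine A b` is a single affine layer, `snoc N A b` puts the layer `(A, b)` on top
of `N`. Hidden widths are arbitrary, and every network has depth at least one. -/
inductive MLP : ℕ → ℕ → ℕ → Type
  | affine {a c : ℕ} (A : Matrix (Fin c) (Fin a) ℝ) (b : Fin c → ℝ) : MLP 1 a c
  | snoc {l a h c : ℕ} (N : MLP l a h) (A : Matrix (Fin c) (Fin h) ℝ) (b : Fin c → ℝ) :
      MLP (l + 1) a c

namespace MLP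

/-- The function computed by the network, with ReLU activations between consecutive layers:
`(A⁽ᴸ⁾ ReLU(·) + b⁽ᴸ⁾) ∘ ⋯ ∘ (A⁽¹⁾ x + b⁽¹⁾)`. -/
def eval : {l a c : ℕ} → MLP l a c → (Fin a → ℝ) → Fin c → ℝ
  | _, _, _, affine A b, x => A.mulVec x + b
  | _, _, _, snoc N A b, x => A.mulVec (fun i => max 0 (N.eval x i)) + b

/-- The output dimension `W_l` of every layer `l = 1, …, L` is at most `W`; nothing is asked of the
input dimension `W_0`. -/
def WidthLE (W : ℕ) : {l a c : ℕ} → MLP l a c → Prop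
  | _, _, c, affine _ _ => c ≤ W
  | _, _, c, snoc N _ _ => N.WidthLE W ∧ c ≤ W

/-- Number of nonzero entries of a vector. -/
def vecNnz {c : ℕ} (b : Fin c → ℝ) : ℕ := {i | b i ≠ 0}.ncard

/-- Number of nonzero entries of a matrix. -/
def matNnz {c a : ℕ} (A : Matrix (Fin c) (Fin a) ℝ) : ℕ :=
  {p : Fin c × Fin a | A p.1 p.2 ≠ 0}.ncard

/-- Total number of nonzero weights and biases. -/
def nnz : {l a c : ℕ} → MLP l a c → ℕ
  | _, _, _, affine A b => matNnz A + vecNnz b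
  | _, _, _, snoc N A b => N.nnz + (matNnz A + vecNnz b)

/-- All weights and biases lie in `[-B, B]`. -/
def EntriesLE (B : ℝ) : {l a c : ℕ} → MLP l a c → Prop
  | _, _, _, affine A b => (∀ i j, |A i j| ≤ B) ∧ ∀ i, |b i| ≤ B
  | _, _, _, snoc N A b => N.EntriesLE B ∧ (∀ i j, |A i j| ≤ B) ∧ ∀ i, |b i| ≤ B

/-- The parameter space `𝒲(L, W, S, B)` of networks from `ℝᵃ` to `ℝᶜ`: depth `L`, width at
most `W`, at most `S` nonzero parameters, all parameters bounded by `B`. -/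
def paramSpace (L W S : ℕ) (B : ℝ) (a c : ℕ) : Set (MLP L a c) :=
  {N | N.WidthLE W ∧ N.nnz ≤ S ∧ N.EntriesLE B}

end MLP

namespace ARM

/-- Parameters shared by all sources: token embedding matrix, encoding layer and MLP. -/
structure Shared (D M de L : ℕ) where
  VX : Matrix (Fin M) (Fin de) ℝ
  A0 : Matrix (Fin D) (Fin de) ℝ
  b0 : Fin D → ℝ
  net : MLP L D M

/-- The space `Φ = [0,1]^{de}` of source-specific embeddings. -/
def sourceSpace (de : ℕ) : Set (Fin de → ℝ) := {φ | ∀ j, φ j ∈ Set.Icc (0 : ℝ) 1}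

/-- The space `Ψ = [0,1]^{M × de} × [-B,B]^{D × de} × [-B,B]^D × 𝒲(L,W,S,B)`. -/
def sharedSpace (D M de L W S : ℕ) (B : ℝ) : Set (Shared D M de L) :=
  {ψ | (∀ m j, ψ.VX m j ∈ Set.Icc (0 : ℝ) 1) ∧ (∀ d j, ψ.A0 d j ∈ Set.Icc (-B) B) ∧
    (∀ d, ψ.b0 d ∈ Set.Icc (-B) B) ∧ ψ.net ∈ MLP.paramSpace L W S B D M}

variable {D M K de L : ℕ}

/-- The stacked embeddings: the first row is the embedding `φ` of the source, the following rows
are the embeddings of the first `D - 1` tokens of `x`. -/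
def embed (φ : Fin de → ℝ) (VX : Matrix (Fin M) (Fin de) ℝ) (x : Fin D → Fin M) :
    Matrix (Fin D) (Fin de) ℝ :=
  fun d => if d.val = 0 then φ else VX (x ⟨d.val - 1, lt_of_le_of_lt (Nat.sub_le _ _) d.isLt⟩)

/-- The sigmoid encoding of each embedding. -/
def encode (A0 : Matrix (Fin D) (Fin de) ℝ) (b0 : Fin D → ℝ) (E : Matrix (Fin D) (Fin de) ℝ) :
    Fin D → ℝ :=
  fun d => Real.sigmoid (A0 d ⬝ᵥ E d + b0 d)

/-- Keep the entries up to position `d` (inclusive) and replace the others by zero. -/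
def mask (d : Fin D) (v : Fin D → ℝ) : Fin D → ℝ := fun j => if j ≤ d then v j else 0

/-- The softmax map. -/
def softmax (h : Fin M → ℝ) : Fin M → ℝ := fun m => Real.exp (h m) / ∑ i, Real.exp (h i)

/-- The categorical parameter of token `d`; it depends on `x` only through the tokens before
position `d`. -/
def rho (φ : Fin de → ℝ) (ψ : Shared D M de L) (x : Fin D → Fin M) (d : Fin D) : Fin M → ℝ :=
  softmax (ψ.net.eval (mask d (encode ψ.A0 ψ.b0 (embed φ ψ.VX x))))

/-- The autoregressive probability mass function `p_{φ,ψ}` of one source. -/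
def density (φ : Fin de → ℝ) (ψ : Shared D M de L) (x : Fin D → Fin M) : ℝ :=
  ∏ d, rho φ ψ x d (x d)

/-- The multi-source conditional distribution space: functions `p`, with `p x y` standing for
`p(x | y)`, with one embedding `φ k ∈ Φ` per source and one `ψ ∈ Ψ` for all sources. -/
def multiSpace (D M K de L W S : ℕ) (B : ℝ) : Set ((Fin D → Fin M) → Fin K → ℝ) :=
  {p | ∃ φ : Fin K → Fin de → ℝ, ∃ ψ : Shared D M de L,
    (∀ k, φ k ∈ sourceSpace de) ∧ ψ ∈ sharedSpace D M de L W S B ∧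
      ∀ x k, p x k = density (φ k) ψ x}

/-- The conditional likelihood of a sample of size `n`. -/
def likelihood {n : ℕ} (s : Fin n → (Fin D → Fin M) × Fin K)
    (p : (Fin D → Fin M) → Fin K → ℝ) : ℝ :=
  ∏ i, p (s i).1 (s i).2

/-- `p` is a maximizer of the conditional likelihood of the sample `s` over the space `P`. -/
def IsMLE {n : ℕ} (P : Set ((Fin D → Fin M) → Fin K → ℝ)) (s : Fin n → (Fin D → Fin M) × Fin K)
    (p : (Fin D → Fin M) → Fin K → ℝ) : Prop :=
  p ∈ P ∧ ∀ q ∈ P, likelihood s q ≤ likelihood s p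

/-- The joint law of `(X, Y)` with label law `pY` and conditional mass function `p`. -/
def jointLaw (pY : PMF (Fin K)) (p : (Fin D → Fin M) → Fin K → ℝ) :
    Measure ((Fin D → Fin M) × Fin K) :=
  ∑ z : (Fin D → Fin M) × Fin K, (ENNReal.ofReal (p z.1 z.2) * pY z.2) • Measure.dirac z

/-- Average total variation error `𝔼_Y [TV(q(·|Y), p(·|Y))]`. -/
def avgTV (pY : PMF (Fin K)) (q p : (Fin D → Fin M) → Fin K → ℝ) : ℝ :=
  ∑ y, (pY y).toReal * ((1 / 2) * ∑ x, |q x y - p x y|)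

end ARM

end

/-! The proof is the classical Hellinger argument for maximum likelihood, over a class that is
finite up to multiplicative error.

Fix one `q` in the class. The square root of its likelihood ratio to the truth has mean equal to the
n-th power of the Hellinger affinity, which is at most `exp (-n * TV² / 2)`. By Markov's inequality,
a `q` far from the truth almost never comes within a factor `e` of the true likelihood
(`IsCondPMF.real_likelihood_ratio_le`).

To pass to the whole class, every parameter is rounded to a grid. Two models with the same code have
mass functions within a factor `exp (1 / n)` pointwise, so replacing the maximizer by a
representative of its code costs a factor `e` in likelihood and `1 / n` in total variation. A union
bound over codes then suffices (`IsCondPMF.mle_avgTV_le`); neither measurability of a selected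
maximizer nor its existence is needed.

It remains to count codes. A perturbation `η` of the parameters is amplified by at most about `(b *
(W + D + 1)) ^ L` through the network (`MLP.forward_lipschitz`, `HasCode.le_exp_mul`), so `η = Λ ^
(-(2L + 4))` is fine enough, where `Λ` is the argument of the logarithm in the bound. Each of the `D
+ (D + M + K) * de` dense parameters and each of the `S` nonzero weights, position included, then
costs `O(L * log Λ)` in log-cardinality (`card_code_le_exp`). This is the source of the factor `L`,
and sparsity is why only `S` enters, not the full size of the network. -/

namespace ARM

/-! ### Hellinger affinity, likelihood ratios and the union bound. -/

variable {D M K : ℕ}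

/-- A strictly positive conditional probability mass function. -/
structure IsCondPMF (p : (Fin D → Fin M) → Fin K → ℝ) : Prop where
  pos : ∀ x k, 0 < p x k
  sum_eq_one : ∀ k, ∑ x, p x k = 1

theorem sum_toReal_pmf (pY : PMF (Fin K)) : ∑ y, (pY y).toReal = 1 := by
  have h := pY.tsum_coe
  rw [tsum_fintype] at h
  rw [← ENNReal.toReal_sum fun y _ => pY.apply_ne_top y, h, ENNReal.toReal_one]

theorem IsCondPMF.sum_weight {p : (Fin D → Fin M) → Fin K → ℝ} (hp : IsCondPMF p)
    (pY : PMF (Fin K)) :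
    ∑ z : (Fin D → Fin M) × Fin K, (pY z.2).toReal * p z.1 z.2 = 1 := by
  rw [Fintype.sum_prod_type_right]
  simp only [← Finset.mul_sum, hp.sum_eq_one, mul_one, sum_toReal_pmf]

theorem IsCondPMF.isProbabilityMeasure_jointLaw {p : (Fin D → Fin M) → Fin K → ℝ}
    (hp : IsCondPMF p) (pY : PMF (Fin K)) : IsProbabilityMeasure (jointLaw pY p) := by
  constructor
  simp only [jointLaw, Measure.finsetSum_apply, Measure.smul_apply, measure_univ, smul_eq_mul,
    mul_one]
  have h (z : (Fin D → Fin M) × Fin K) : ENNReal.ofReal (p z.1 z.2) * pY z.2 =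
      ENNReal.ofReal ((pY z.2).toReal * p z.1 z.2) := by
    rw [ENNReal.ofReal_mul ENNReal.toReal_nonneg, ENNReal.ofReal_toReal (pY.apply_ne_top _),
      mul_comm]
  simp only [h]
  rw [← ENNReal.ofReal_sum_of_nonneg fun z _ =>
    mul_nonneg ENNReal.toReal_nonneg (hp.pos _ _).le, hp.sum_weight, ENNReal.ofReal_one]

theorem IsCondPMF.integral_jointLaw {p : (Fin D → Fin M) → Fin K → ℝ} (hp : IsCondPMF p)
    (pY : PMF (Fin K)) (f : (Fin D → Fin M) × Fin K → ℝ) :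
    ∫ z, f z ∂jointLaw pY p = ∑ z, (pY z.2).toReal * p z.1 z.2 * f z := by
  have hne (z : (Fin D → Fin M) × Fin K) : ENNReal.ofReal (p z.1 z.2) * pY z.2 ≠ ⊤ :=
    ENNReal.mul_ne_top ENNReal.ofReal_ne_top (pY.apply_ne_top _)
  rw [jointLaw, integral_finsetSum_measure fun z _ =>
    (integrable_dirac (by simp)).smul_measure (hne z)]
  refine Finset.sum_congr rfl fun z _ => ?_
  rw [integral_smul_measure, integral_dirac, ENNReal.toReal_mul,
    ENNReal.toReal_ofReal (hp.pos _ _).le, smul_eq_mul, mul_comm (p _ _)]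

theorem avgTV_eq_sum (pY : PMF (Fin K)) (q p : (Fin D → Fin M) → Fin K → ℝ) :
    avgTV pY q p = (1 / 2) * ∑ z : (Fin D → Fin M) × Fin K,
      (pY z.2).toReal * |q z.1 z.2 - p z.1 z.2| := by
  rw [Fintype.sum_prod_type_right, avgTV, Finset.mul_sum]
  refine Finset.sum_congr rfl fun y _ => ?_
  simp only [← Finset.mul_sum]
  ring

theorem avgTV_triangle (pY : PMF (Fin K)) (p q r : (Fin D → Fin M) → Fin K → ℝ) :
    avgTV pY p r ≤ avgTV pY p q + avgTV pY q r := by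
  simp only [avgTV_eq_sum]
  rw [← mul_add, ← Finset.sum_add_distrib]
  gcongr with z
  rw [← mul_add]
  gcongr
  exact abs_sub_le _ _ _

/-- Cauchy–Schwarz on `|q - p| = |√q - √p| * (√q + √p)` gives `TV² ≤ 2 * (1 - A)` for the affinity
`A`; then `1 - s ≤ exp (-s)`. -/
theorem IsCondPMF.sum_weight_mul_sqrt_le {p q : (Fin D → Fin M) → Fin K → ℝ}
    (hp : IsCondPMF p) (hq : IsCondPMF q) (pY : PMF (Fin K)) :
    ∑ z : (Fin D → Fin M) × Fin K, (pY z.2).toReal * (√(q z.1 z.2) * √(p z.1 z.2)) ≤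
      Real.exp (-(avgTV pY q p ^ 2 / 2)) := by
  set A := ∑ z : (Fin D → Fin M) × Fin K, (pY z.2).toReal * (√(q z.1 z.2) * √(p z.1 z.2))
  set w : (Fin D → Fin M) × Fin K → ℝ := fun z => (pY z.2).toReal
  have hw (z) : 0 ≤ w z := ENNReal.toReal_nonneg
  have hsq (z) : √(w z) ^ 2 = w z := Real.sq_sqrt (hw z)
  have hpq (z : (Fin D → Fin M) × Fin K) : √(p z.1 z.2) ^ 2 = p z.1 z.2 :=
    Real.sq_sqrt (hp.pos _ _).le
  have hqq (z : (Fin D → Fin M) × Fin K) : √(q z.1 z.2) ^ 2 = q z.1 z.2 :=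
    Real.sq_sqrt (hq.pos _ _).le
  have hcs := Finset.sum_mul_sq_le_sq_mul_sq Finset.univ
    (fun z : (Fin D → Fin M) × Fin K => √(w z) * |√(q z.1 z.2) - √(p z.1 z.2)|)
    (fun z => √(w z) * (√(q z.1 z.2) + √(p z.1 z.2)))
  have h1 : ∑ z : (Fin D → Fin M) × Fin K, (√(w z) * |√(q z.1 z.2) - √(p z.1 z.2)|) *
      (√(w z) * (√(q z.1 z.2) + √(p z.1 z.2))) = 2 * avgTV pY q p := by
    rw [avgTV_eq_sum, ← mul_assoc]
    norm_num
    refine Finset.sum_congr rfl fun z _ => ?_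
    have habs : |q z.1 z.2 - p z.1 z.2| =
        |√(q z.1 z.2) - √(p z.1 z.2)| * (√(q z.1 z.2) + √(p z.1 z.2)) := by
      rw [← abs_of_nonneg (add_nonneg (Real.sqrt_nonneg (q z.1 z.2))
        (Real.sqrt_nonneg (p z.1 z.2))), ← abs_mul]
      congr 1
      linear_combination -(hqq z) + hpq z
    rw [habs]
    linear_combination (|√(q z.1 z.2) - √(p z.1 z.2)| * (√(q z.1 z.2) + √(p z.1 z.2))) * hsq z
  have h2 : ∑ z : (Fin D → Fin M) × Fin K, (√(w z) * |√(q z.1 z.2) - √(p z.1 z.2)|) ^ 2 =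
      2 - 2 * A := by
    have : ∀ z : (Fin D → Fin M) × Fin K, (√(w z) * |√(q z.1 z.2) - √(p z.1 z.2)|) ^ 2 =
        w z * q z.1 z.2 + w z * p z.1 z.2 - 2 * (w z * (√(q z.1 z.2) * √(p z.1 z.2))) := by
      intro z
      rw [mul_pow, sq_abs, hsq]
      linear_combination w z * hqq z + w z * hpq z
    simp only [this, Finset.sum_sub_distrib, Finset.sum_add_distrib, ← Finset.mul_sum]
    rw [hp.sum_weight, hq.sum_weight]
    norm_num [A, w]
  have h3 : ∑ z : (Fin D → Fin M) × Fin K, (√(w z) * (√(q z.1 z.2) + √(p z.1 z.2))) ^ 2 ≤ 4 := by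
    calc _ ≤ ∑ z : (Fin D → Fin M) × Fin K, 2 * (w z * q z.1 z.2 + w z * p z.1 z.2) := by
          refine Finset.sum_le_sum fun z _ => ?_
          rw [mul_pow, hsq]
          have : (√(q z.1 z.2) + √(p z.1 z.2)) ^ 2 ≤ 2 * (q z.1 z.2 + p z.1 z.2) := by
            nlinarith [sq_nonneg (√(q z.1 z.2) - √(p z.1 z.2)), hqq z, hpq z]
          nlinarith [mul_le_mul_of_nonneg_left this (hw z)]
      _ = 4 := by
          rw [← Finset.mul_sum, Finset.sum_add_distrib, hp.sum_weight, hq.sum_weight]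
          norm_num
  have h0 : 0 ≤ 2 - 2 * A := h2 ▸ Finset.sum_nonneg fun _ _ => sq_nonneg _
  rw [h1, h2] at hcs
  have h4 := hcs.trans (mul_le_mul_of_nonneg_left h3 h0)
  have h5 := Real.add_one_le_exp (-(avgTV pY q p ^ 2 / 2))
  nlinarith

theorem pi_real_le_prod {Z : Type*} [Fintype Z] [MeasurableSpace Z] [MeasurableSingletonClass Z]
    (μ : Measure Z) [IsProbabilityMeasure μ] {n : ℕ} (f : Z → ℝ) (hf : ∀ z, 0 ≤ f z) (c : ℝ) :
    c * (Measure.pi fun _ : Fin n => μ).real {s | c ≤ ∏ i, f (s i)} ≤ (∫ z, f z ∂μ) ^ n := by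
  have h := mul_meas_ge_le_integral_of_nonneg (μ := Measure.pi fun _ : Fin n => μ)
    (f := fun s => ∏ i, f (s i)) (ae_of_all _ fun s => Finset.prod_nonneg fun i _ => hf _)
    Integrable.of_finite c
  rwa [integral_fintype_prod_eq_pow, Fintype.card_fin] at h

/-- The likelihood ratio of `q` to the truth is exponentially small if `q` is far from it. -/
theorem IsCondPMF.real_likelihood_ratio_le {p q : (Fin D → Fin M) → Fin K → ℝ}
    (hp : IsCondPMF p) (hq : IsCondPMF q) (pY : PMF (Fin K)) (n : ℕ) {t : ℝ} (ht : 0 ≤ t)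
    (htv : t ≤ avgTV pY q p) :
    (Measure.pi fun _ : Fin n => jointLaw pY p).real
      {s | Real.exp (-1) * likelihood s p ≤ likelihood s q} ≤
      Real.exp (1 / 2 - n * t ^ 2 / 2) := by
  have := hp.isProbabilityMeasure_jointLaw pY
  have h := pi_real_le_prod (n := n) (jointLaw pY p)
    (fun z => √(q z.1 z.2) / √(p z.1 z.2)) (fun z => by positivity) (Real.exp (-(1 / 2)))
  have hint : ∫ z, √(q z.1 z.2) / √(p z.1 z.2) ∂jointLaw pY p ≤ Real.exp (-(t ^ 2 / 2)) := by
    rw [hp.integral_jointLaw]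
    calc _ = ∑ z : (Fin D → Fin M) × Fin K,
          (pY z.2).toReal * (√(q z.1 z.2) * √(p z.1 z.2)) := by
          refine Finset.sum_congr rfl fun z _ => ?_
          have h1 := Real.sqrt_pos.2 (hp.pos z.1 z.2)
          have h2 := Real.sq_sqrt (hp.pos z.1 z.2).le
          field_simp
          linear_combination -((pY z.2).toReal * √(q z.1 z.2)) * h2
      _ ≤ _ := hp.sum_weight_mul_sqrt_le hq pY
      _ ≤ _ := by gcongr
  have hint0 : 0 ≤ ∫ z, √(q z.1 z.2) / √(p z.1 z.2) ∂jointLaw pY p :=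
    integral_nonneg fun z => by positivity
  -- Taking square roots turns the threshold `exp (-1)` into `exp (-(1 / 2))`; Markov's inequality
  -- then contributes the `1 / 2` in the exponent.
  have hsub : {s : Fin n → (Fin D → Fin M) × Fin K |
        Real.exp (-1) * likelihood s p ≤ likelihood s q} ⊆
      {s | Real.exp (-(1 / 2)) ≤ ∏ i, √(q (s i).1 (s i).2) / √(p (s i).1 (s i).2)} := by
    intro s hs
    have hP : 0 < likelihood s p := Finset.prod_pos fun i _ => hp.pos _ _
    have hs' : Real.exp (-1) * likelihood s p ≤ likelihood s q := hs
    have h1 := Real.sqrt_le_sqrt hs'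
    rw [Real.sqrt_mul (Real.exp_pos _).le, ← Real.exp_half] at h1
    have h2 (r : (Fin D → Fin M) → Fin K → ℝ) (hr : IsCondPMF r) :
        √(likelihood s r) = ∏ i, √(r (s i).1 (s i).2) := by
      simp only [likelihood, Real.sqrt_eq_rpow]
      exact (Real.finsetProd_rpow _ _ (fun i _ => (hr.pos _ _).le) _).symm
    rw [Set.mem_ofPred_eq, Finset.prod_div_distrib, ← h2 p hp, ← h2 q hq,
      le_div_iff₀ (Real.sqrt_pos.2 hP), ← neg_div]
    exact h1
  have hmono := measureReal_mono (μ := Measure.pi fun _ : Fin n => jointLaw pY p) hsub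
  have hpow := pow_le_pow_left₀ hint0 hint n
  rw [← Real.exp_nat_mul] at hpow
  have h6 := (mul_le_mul_of_nonneg_left hmono (Real.exp_pos (-(1 / 2))).le).trans (h.trans hpow)
  calc _ = Real.exp (1 / 2) * (Real.exp (-(1 / 2)) * _) := by
        rw [← mul_assoc, ← Real.exp_add]; norm_num
    _ ≤ Real.exp (1 / 2) * _ := mul_le_mul_of_nonneg_left h6 (Real.exp_pos _).le
    _ = _ := by
        rw [← Real.exp_add]; congr 1; ring

/-- On `[0, 1]`, `exp r ≤ 1 + 2 * r` and `exp (-r) ≥ 1 - r`, so `|p - q| ≤ 2 * r * q`; the factor 2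
cancels the `1 / 2` of total variation. -/
theorem avgTV_le_of_mem_exp_band {p q : (Fin D → Fin M) → Fin K → ℝ} (hq : IsCondPMF q)
    (pY : PMF (Fin K)) {r : ℝ} (hr0 : 0 ≤ r) (hr1 : r ≤ 1)
    (h1 : ∀ x k, p x k ≤ Real.exp r * q x k) (h2 : ∀ x k, q x k ≤ Real.exp r * p x k) :
    avgTV pY p q ≤ r := by
  rw [avgTV_eq_sum]
  have hb (x k) : |p x k - q x k| ≤ 2 * r * q x k := by
    have e1 := Real.abs_exp_sub_one_le (x := r) (by rwa [abs_of_nonneg hr0])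
    rw [abs_of_nonneg hr0] at e1
    have e2 := (abs_le.1 e1).2
    have e3 := Real.add_one_le_exp (-r)
    have hqp := (hq.pos x k).le
    rw [abs_le]
    constructor
    · have e4 : Real.exp (-r) * q x k ≤ p x k := by
        rw [Real.exp_neg, inv_mul_le_iff₀ (Real.exp_pos _)]
        exact h2 x k
      nlinarith [mul_le_mul_of_nonneg_right e3 hqp, mul_nonneg hr0 hqp]
    · nlinarith [h1 x k, mul_le_mul_of_nonneg_right e2 hqp]
  calc _ ≤ (1 / 2) * ∑ z : (Fin D → Fin M) × Fin K, 2 * r * ((pY z.2).toReal * q z.1 z.2) := by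
        refine mul_le_mul_of_nonneg_left (Finset.sum_le_sum fun z _ => ?_) (by norm_num)
        have := mul_le_mul_of_nonneg_left (hb z.1 z.2) (ENNReal.toReal_nonneg (a := pY z.2))
        linarith
    _ = r := by
        rw [← Finset.mul_sum, hq.sum_weight]
        ring

/-- Tail bound for maximum likelihood over a class that is finite up to factors `exp (1 / n)`. -/
theorem IsCondPMF.mle_avgTV_le {P : Set ((Fin D → Fin M) → Fin K → ℝ)}
    (hP : ∀ p ∈ P, IsCondPMF p) {J : Type*} [Fintype J]
    (R : ((Fin D → Fin M) → Fin K → ℝ) → J → Prop) (hex : ∀ p ∈ P, ∃ j, R p j) {n : ℕ}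
    (hn : 1 ≤ n)
    (hR : ∀ p ∈ P, ∀ q ∈ P, ∀ j, R p j → R q j → ∀ x k, p x k ≤ Real.exp (1 / n) * q x k)
    (pY : PMF (Fin K)) {pstar : (Fin D → Fin M) → Fin K → ℝ} (hstar : pstar ∈ P)
    {t δ : ℝ} (ht : 0 ≤ t) (htδ : Fintype.card J * Real.exp (1 / 2 - n * t ^ 2 / 2) ≤ δ) :
    ENNReal.ofReal (1 - δ) ≤ (Measure.pi fun _ : Fin n => jointLaw pY pstar)
      {s | ∀ phat, IsMLE P s phat → avgTV pY phat pstar ≤ t + 1 / n} := by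
  classical
  have hn0 : (0 : ℝ) < n := by exact_mod_cast hn
  have hs := hP _ hstar
  have := hs.isProbabilityMeasure_jointLaw pY
  set μ := Measure.pi fun _ : Fin n => jointLaw pY pstar
  -- Representatives lie in `P`, so they are themselves positive and normalized. The value `pstar`
  -- at codes that no model has keeps this true for every `j`.
  let rep : J → (Fin D → Fin M) → Fin K → ℝ := fun j =>
    if h : ∃ p ∈ P, R p j then h.choose else pstar
  have hrepP (j) : rep j ∈ P := by
    by_cases h : ∃ p ∈ P, R p j
    · simp only [rep, dif_pos h]; exact h.choose_spec.1
    · simpa only [rep, dif_neg h]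
  have hrepR (p) (hp : p ∈ P) (j) (hj : R p j) : R (rep j) j := by
    have h : ∃ p ∈ P, R p j := ⟨p, hp, hj⟩
    simp only [rep, dif_pos h]; exact h.choose_spec.2
  -- The distance condition does not depend on the sample: a code whose representative is close to
  -- the truth contributes the empty event.
  let bad : J → Set (Fin n → (Fin D → Fin M) × Fin K) := fun j =>
    {s | t ≤ avgTV pY (rep j) pstar ∧ Real.exp (-1) * likelihood s pstar ≤ likelihood s (rep j)}
  have hbad (j) : μ.real (bad j) ≤ Real.exp (1 / 2 - n * t ^ 2 / 2) := by
    by_cases h : t ≤ avgTV pY (rep j) pstar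
    · simp only [bad, h, true_and]
      exact hs.real_likelihood_ratio_le (hP _ (hrepP j)) pY n ht h
    · simp only [bad, h, false_and, Set.ofPred_false, measureReal_empty]
      positivity
  have hunion : μ.real (⋃ j, bad j) ≤ δ :=
    calc _ ≤ ∑ j, μ.real (bad j) := measureReal_iUnion_fintype_le _
      _ ≤ ∑ _j : J, Real.exp (1 / 2 - n * t ^ 2 / 2) := Finset.sum_le_sum fun j _ => hbad j
      _ ≤ δ := by simpa using htδ
  have hsub : (⋃ j, bad j)ᶜ ⊆
      {s | ∀ phat, IsMLE P s phat → avgTV pY phat pstar ≤ t + 1 / n} := by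
    intro s hsb phat hmle
    obtain ⟨j, hj⟩ := hex phat hmle.1
    have hjr := hrepR _ hmle.1 _ hj
    have hpos1 : ∀ x k, 0 < rep j x k := (hP _ (hrepP j)).pos
    have hlik : Real.exp (-1) * likelihood s pstar ≤ likelihood s (rep j) := by
      have h1 := hmle.2 _ hstar
      -- The `n` factors `exp (1 / n)` multiply to `e`.
      have h2 : likelihood s phat ≤ Real.exp 1 * likelihood s (rep j) := by
        calc likelihood s phat
            ≤ ∏ i, Real.exp (1 / n) * rep j (s i).1 (s i).2 :=
              Finset.prod_le_prod (fun i _ => ((hP _ hmle.1).pos _ _).le)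
                fun i _ => hR _ hmle.1 _ (hrepP j) j hj hjr _ _
          _ = _ := by
              rw [Finset.prod_mul_distrib, Finset.prod_const, Finset.card_univ, Fintype.card_fin,
                ← Real.exp_nat_mul, mul_one_div_cancel hn0.ne']
              rfl
      rw [Real.exp_neg, inv_mul_le_iff₀ (Real.exp_pos _)]
      exact h1.trans h2
    have hlt : avgTV pY (rep j) pstar ≤ t := by
      by_contra hcon
      exact hsb (Set.mem_iUnion.2 ⟨j, (not_le.1 hcon).le, hlik⟩)
    have hclose : avgTV pY phat (rep j) ≤ 1 / n :=
      avgTV_le_of_mem_exp_band (hP _ (hrepP j)) pY (by positivity)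
        (by rw [div_le_one hn0]; exact_mod_cast hn)
        (hR _ hmle.1 _ (hrepP j) j hj hjr) (hR _ (hrepP j) _ hmle.1 j hjr hj)
    linarith [avgTV_triangle pY phat (rep j) pstar]
  refine le_trans ?_ (measure_mono hsub)
  rw [← ofReal_measureReal]
  refine ENNReal.ofReal_le_ofReal ?_
  rw [probReal_compl_eq_one_sub (Set.toFinite _).measurableSet]
  linarith

end ARM

/-! ### Networks as zero-padded weight arrays; growth and stability of the forward pass. -/

namespace MLP

/-- The weights of one layer, extended by zero; column `0` holds the biases. -/
noncomputable def padLayer {a c : ℕ} (A : Matrix (Fin c) (Fin a) ℝ) (b : Fin c → ℝ) (i : ℕ) :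
    ℕ → ℝ
  | 0 => if hi : i < c then b ⟨i, hi⟩ else 0
  | j + 1 => if h : i < c ∧ j < a then A ⟨i, h.1⟩ ⟨j, h.2⟩ else 0

/-- All weights of a network as an array indexed by layer, row and column, extended by zero. -/
noncomputable def pad : {l a c : ℕ} → MLP l a c → ℕ → ℕ → ℕ → ℝ
  | _, _, _, affine A b, k => if k = 0 then padLayer A b else 0
  | l + 1, _, _, snoc N A b, k => if k = l then padLayer A b else N.pad k

/-- Forward pass of a network given by an array of weights, with ReLU before every layer. -/
noncomputable def forward (R : ℕ) (θ : ℕ → ℕ → ℕ → ℝ) (x : ℕ → ℝ) : ℕ → ℕ → ℝ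
  | 0 => x
  | l + 1 => fun i => θ l i 0 + ∑ j ∈ Finset.range R, θ l i (j + 1) * max 0 (forward R θ x l j)

theorem forward_congr {R : ℕ} {θ θ' : ℕ → ℕ → ℕ → ℝ} {x : ℕ → ℝ} {l : ℕ}
    (h : ∀ k < l, θ k = θ' k) : forward R θ x l = forward R θ' x l := by
  induction l with
  | zero => rfl
  | succ l ih =>
    simp only [forward, ih fun k hk => h k (hk.trans l.lt_succ_self), h l l.lt_succ_self]

theorem padLayer_sum {a c R : ℕ} (A : Matrix (Fin c) (Fin a) ℝ) (b : Fin c → ℝ) (ha : a ≤ R)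
    (i : Fin c) (v : ℕ → ℝ) :
    padLayer A b i 0 + ∑ j ∈ Finset.range R, padLayer A b i (j + 1) * v j =
      (A.mulVec (fun j => v j) + b) i := by
  rw [← Finset.sum_subset (Finset.range_subset_range.2 ha), Finset.sum_range]
  · simp [padLayer, Matrix.mulVec, dotProduct, add_comm]
  · intro j _ hj
    have : ¬ j < a := by simpa using hj
    simp [padLayer, this]

theorem WidthLE.out_le {W : ℕ} : {l a c : ℕ} → {N : MLP l a c} → N.WidthLE W → c ≤ W
  | _, _, _, affine _ _, h => h
  | _, _, _, snoc _ _ _, h => h.2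

/-- Padding lets networks with different hidden widths be compared entry by entry. The extra ReLU
that `forward` applies to the input is harmless because the input is nonnegative. -/
theorem eval_eq_forward {W R : ℕ} (hW : W ≤ R) : {l a c : ℕ} → (N : MLP l a c) → N.WidthLE W →
    a ≤ R → (x : Fin a → ℝ) → (∀ j, 0 ≤ x j) → (i : Fin c) →
    N.eval x i = forward R N.pad (fun j => if h : j < a then x ⟨j, h⟩ else 0) l i
  | _, _, _, affine A b, _, ha, x, hx, i => by
    simp only [forward, pad, if_true, eval]
    rw [padLayer_sum A b ha i]
    simp [hx]
  | l + 1, a, c, snoc (h := h) N A b, hN, ha, x, hx, i => by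
    have ih := eval_eq_forward hW N hN.1 ha x hx
    have hc : forward R (snoc N A b).pad (fun j => if h : j < a then x ⟨j, h⟩ else 0) l =
        forward R N.pad (fun j => if h : j < a then x ⟨j, h⟩ else 0) l :=
      forward_congr fun k hk => by simp [pad, hk.ne]
    simp only [forward, hc, eval]
    simp only [pad, if_true]
    rw [padLayer_sum A b (hN.1.out_le.trans hW) i]
    simp only [ih]

theorem abs_padLayer_le {a c : ℕ} {A : Matrix (Fin c) (Fin a) ℝ} {b : Fin c → ℝ} {B : ℝ}
    (hB : 0 ≤ B) (hA : ∀ i j, |A i j| ≤ B) (hb : ∀ i, |b i| ≤ B) (i j : ℕ) :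
    |padLayer A b i j| ≤ B := by
  cases j with
  | zero =>
    rw [padLayer]
    split_ifs
    exacts [hb _, by simpa]
  | succ j =>
    rw [padLayer]
    split_ifs
    exacts [hA _ _, by simpa]

theorem EntriesLE.abs_pad_le {B : ℝ} (hB : 0 ≤ B) : {l a c : ℕ} → {N : MLP l a c} →
    N.EntriesLE B → ∀ k i j, |N.pad k i j| ≤ B
  | _, _, _, affine A b, h, k, i, j => by
    rw [pad]
    split_ifs
    exacts [abs_padLayer_le hB h.1 h.2 i j, by simpa]
  | _, _, _, snoc N A b, h, k, i, j => by
    rw [pad]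
    split_ifs
    exacts [abs_padLayer_le hB h.2.1 h.2.2 i j, h.1.abs_pad_le hB k i j]

theorem encard_padLayer_le {a c : ℕ} (A : Matrix (Fin c) (Fin a) ℝ) (b : Fin c → ℝ) :
    {p : ℕ × ℕ | padLayer A b p.1 p.2 ≠ 0}.encard ≤ (matNnz A + vecNnz b : ℕ) := by
  have hsub : {p : ℕ × ℕ | padLayer A b p.1 p.2 ≠ 0} ⊆
      (fun p : Fin c × Fin a => ((p.1 : ℕ), (p.2 : ℕ) + 1)) '' {p | A p.1 p.2 ≠ 0} ∪
      (fun i : Fin c => ((i : ℕ), 0)) '' {i | b i ≠ 0} := by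
    rintro ⟨i, j⟩ hp
    cases j with
    | zero =>
      simp only [padLayer, Set.mem_ofPred_eq] at hp
      split_ifs at hp with hi
      · exact Or.inr ⟨⟨i, hi⟩, hp, rfl⟩
      · exact absurd rfl hp
    | succ j =>
      simp only [padLayer, Set.mem_ofPred_eq] at hp
      split_ifs at hp with hi
      · exact Or.inl ⟨(⟨i, hi.1⟩, ⟨j, hi.2⟩), hp, rfl⟩
      · exact absurd rfl hp
  refine (Set.encard_le_encard hsub).trans ((Set.encard_union_le _ _).trans ?_)
  rw [Nat.cast_add, matNnz, vecNnz, (Set.toFinite _).cast_ncard_eq,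
    (Set.toFinite _).cast_ncard_eq]
  exact add_le_add (Set.encard_image_le _ _) (Set.encard_image_le _ _)

theorem encard_pad_le : {l a c : ℕ} → (N : MLP l a c) →
    {p : ℕ × ℕ × ℕ | N.pad p.1 p.2.1 p.2.2 ≠ 0}.encard ≤ (N.nnz : ℕ)
  | _, _, _, affine A b => by
    have hsub : {p : ℕ × ℕ × ℕ | (affine A b).pad p.1 p.2.1 p.2.2 ≠ 0} ⊆
        (fun p : ℕ × ℕ => (0, p)) '' {p : ℕ × ℕ | padLayer A b p.1 p.2 ≠ 0} := by
      rintro ⟨k, p⟩ hp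
      simp only [pad, Set.mem_ofPred_eq] at hp
      split_ifs at hp with hk
      · exact ⟨p, hp, by rw [hk]⟩
      · exact absurd rfl hp
    exact (Set.encard_le_encard hsub).trans
      ((Set.encard_image_le _ _).trans (encard_padLayer_le A b))
  | l + 1, _, _, snoc N A b => by
    have hsub : {p : ℕ × ℕ × ℕ | (snoc N A b).pad p.1 p.2.1 p.2.2 ≠ 0} ⊆
        {p : ℕ × ℕ × ℕ | N.pad p.1 p.2.1 p.2.2 ≠ 0} ∪
        (fun p : ℕ × ℕ => (l, p)) '' {p : ℕ × ℕ | padLayer A b p.1 p.2 ≠ 0} := by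
      rintro ⟨k, p⟩ hp
      simp only [pad, Set.mem_ofPred_eq] at hp
      split_ifs at hp with hk
      · exact Or.inr ⟨p, hp, by rw [hk]⟩
      · exact Or.inl hp
    refine (Set.encard_le_encard hsub).trans ((Set.encard_union_le _ _).trans ?_)
    rw [nnz, Nat.cast_add]
    exact add_le_add (encard_pad_le N)
      ((Set.encard_image_le _ _).trans (encard_padLayer_le A b))

theorem padLayer_eq_zero {a c W R i j : ℕ} {A : Matrix (Fin c) (Fin a) ℝ} {b : Fin c → ℝ}
    (hc : c ≤ W) (ha : a ≤ R) (h : W ≤ i ∨ R < j) : padLayer A b i j = 0 := by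
  cases j with
  | zero =>
    rw [padLayer, dif_neg]
    omega
  | succ j =>
    rw [padLayer, dif_neg]
    omega

theorem forward_growth {R : ℕ} {θ : ℕ → ℕ → ℕ → ℝ} {x : ℕ → ℝ} {B : ℝ} (hB : 1 ≤ B)
    (hθ : ∀ l i j, |θ l i j| ≤ B) (hx : ∀ i, |x i| ≤ 1) (l i : ℕ) :
    |forward R θ x l i| ≤ (B * (R + 1)) ^ l := by
  induction l generalizing i with
  | zero => simpa [forward] using hx i
  | succ l ih =>
    have hA : 1 ≤ B * ((R : ℝ) + 1) := by nlinarith [(Nat.cast_nonneg R : (0 : ℝ) ≤ R)]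
    have hAl : 1 ≤ (B * ((R : ℝ) + 1)) ^ l := one_le_pow₀ hA
    calc |forward R θ x (l + 1) i|
        ≤ |θ l i 0| + ∑ j ∈ Finset.range R, |θ l i (j + 1) * max 0 (forward R θ x l j)| :=
          (abs_add_le _ _).trans (by gcongr; exact Finset.abs_sum_le_sum_abs _ _)
      _ ≤ B + ∑ _j ∈ Finset.range R, B * (B * ((R : ℝ) + 1)) ^ l := by
          gcongr with j
          · exact hθ _ _ _
          · rw [abs_mul]
            gcongr
            · exact hθ _ _ _
            · rw [abs_of_nonneg (le_max_left _ _)]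
              exact max_le (by positivity) ((le_abs_self _).trans (ih j))
      _ ≤ _ := by
          rw [Finset.sum_const, Finset.card_range, nsmul_eq_mul, pow_succ]
          nlinarith

/-- In each layer, `θu - θ'u' = (θ - θ')u + θ'(u - u')`: the first term is controlled by
`forward_growth`, the second by induction, ReLU being 1-Lipschitz. -/
theorem forward_lipschitz {R : ℕ} {θ θ' : ℕ → ℕ → ℕ → ℝ} {x x' : ℕ → ℝ} {B η ε : ℝ}
    (hB : 1 ≤ B) (hη : 0 ≤ η) (hε : 0 ≤ ε)
    (hθ : ∀ l i j, |θ l i j| ≤ B) (hθ' : ∀ l i j, |θ' l i j| ≤ B)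
    (hθθ' : ∀ l i j, |θ l i j - θ' l i j| ≤ η) (hx : ∀ i, |x i| ≤ 1)
    (hxx' : ∀ i, |x i - x' i| ≤ ε) (l i : ℕ) :
    |forward R θ x l i - forward R θ' x' l i| ≤
      (B * (R + 1)) ^ l * (ε + l * (η * (R + 1))) := by
  induction l generalizing i with
  | zero => simpa [forward] using hxx' i
  | succ l ih =>
    have hR : (0 : ℝ) ≤ R := Nat.cast_nonneg R
    set A := B * ((R : ℝ) + 1) with hAdef
    have hA : 1 ≤ A := by nlinarith
    have hAl : 1 ≤ A ^ l := one_le_pow₀ hA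
    set e := A ^ l * (ε + l * (η * (R + 1))) with he
    have he0 : 0 ≤ e := by positivity
    have hterm (j : ℕ) : |θ l i (j + 1) * max 0 (forward R θ x l j) -
        θ' l i (j + 1) * max 0 (forward R θ' x' l j)| ≤ η * A ^ l + B * e := by
      have h1 : θ l i (j + 1) * max 0 (forward R θ x l j) -
          θ' l i (j + 1) * max 0 (forward R θ' x' l j) =
          (θ l i (j + 1) - θ' l i (j + 1)) * max 0 (forward R θ x l j) +
          θ' l i (j + 1) * (max 0 (forward R θ x l j) - max 0 (forward R θ' x' l j)) := by ring
      rw [h1]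
      refine (abs_add_le _ _).trans ?_
      rw [abs_mul, abs_mul]
      gcongr
      · exact hθθ' _ _ _
      · rw [abs_of_nonneg (le_max_left _ _)]
        exact max_le (by positivity)
          ((le_abs_self _).trans (forward_growth hB hθ hx l j))
      · exact hθ' _ _ _
      · rw [max_comm 0, max_comm 0]
        exact (abs_max_sub_max_le_abs _ _ _).trans (ih j)
    calc |forward R θ x (l + 1) i - forward R θ' x' (l + 1) i|
        = |(θ l i 0 - θ' l i 0) + ∑ j ∈ Finset.range R, (θ l i (j + 1) *
            max 0 (forward R θ x l j) - θ' l i (j + 1) * max 0 (forward R θ' x' l j))| := by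
          rw [Finset.sum_sub_distrib]
          simp only [forward]
          congr 1
          ring
      _ ≤ |θ l i 0 - θ' l i 0| + ∑ j ∈ Finset.range R, |θ l i (j + 1) *
            max 0 (forward R θ x l j) - θ' l i (j + 1) * max 0 (forward R θ' x' l j)| :=
          (abs_add_le _ _).trans (by gcongr; exact Finset.abs_sum_le_sum_abs _ _)
      _ ≤ η + ∑ _j ∈ Finset.range R, (η * A ^ l + B * e) := by
          gcongr with j
          · exact hθθ' _ _ _
          · exact hterm j
      _ = η + R * (η * A ^ l) + B * R * e := by
          rw [Finset.sum_const, Finset.card_range, nsmul_eq_mul]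
          ring
      _ ≤ η * (R + 1) * A ^ (l + 1) + A * e := by
          have h1 : A ^ l ≤ A ^ (l + 1) := pow_le_pow_right₀ hA l.le_succ
          have h2 : B * R * e ≤ A * e := by gcongr; rw [hAdef]; nlinarith
          have h3 : η * (R + 1) * A ^ l ≤ η * (R + 1) * A ^ (l + 1) := by gcongr
          nlinarith [mul_le_mul_of_nonneg_left hAl hη]
      _ = _ := by
          rw [he]
          push_cast
          ring

end MLP

/-! ### Autoregressive densities: normalization and perturbation. -/

namespace ARM

variable {D M K de L : ℕ}

/-- Induction on `D`: once the first coordinate is fixed, the remaining factors form an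
autoregressive family of length one less, which sums to 1. -/
theorem sum_prod_autoregressive {α : Type*} [Fintype α] [Nonempty α] {D : ℕ}
    (g : Fin D → (Fin D → α) → α → ℝ)
    (hg : ∀ d x x', (∀ j < d, x j = x' j) → g d x = g d x') (h1 : ∀ d x, ∑ a, g d x a = 1) :
    ∑ x : Fin D → α, ∏ d, g d x (x d) = 1 := by
  induction D with
  | zero => simp
  | succ D ih =>
    obtain ⟨a₀⟩ := ‹Nonempty α›
    rw [← (Fin.consEquiv fun _ => α).sum_comp, Fintype.sum_prod_type]
    have hstep (a : α) : ∑ x : Fin D → α, ∏ d, g d (Fin.cons a x : Fin (D + 1) → α)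
        ((Fin.cons a x : Fin (D + 1) → α) d) = g 0 (fun _ => a₀) a := by
      have h0 (x : Fin D → α) : g 0 (Fin.cons a x : Fin (D + 1) → α) = g 0 fun _ => a₀ :=
        hg _ _ _ fun j hj => absurd hj (Fin.not_lt_zero j)
      simp only [Fin.prod_univ_succ, Fin.cons_zero, Fin.cons_succ, h0, ← Finset.mul_sum]
      rw [ih (fun d x => g d.succ (Fin.cons a x : Fin (D + 1) → α)), mul_one]
      · intro d x x' hx
        refine hg _ _ _ fun j hj => ?_
        induction j using Fin.cases with
        | zero => rfl
        | succ j => simpa using hx j (Fin.succ_lt_succ_iff.1 hj)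
      · exact fun d x => h1 _ _
    exact (Finset.sum_congr rfl fun a _ => hstep a).trans (h1 _ _)

theorem softmax_pos [NeZero M] (h : Fin M → ℝ) (m : Fin M) : 0 < softmax h m :=
  div_pos (Real.exp_pos _) (Finset.sum_pos (fun _ _ => Real.exp_pos _) ⟨m, Finset.mem_univ m⟩)

theorem sum_softmax [NeZero M] (h : Fin M → ℝ) : ∑ m, softmax h m = 1 := by
  simp only [softmax, ← Finset.sum_div]
  exact div_self (Finset.sum_pos (fun _ _ => Real.exp_pos _) ⟨0, Finset.mem_univ _⟩).ne'

/-- Numerator and denominator each change by a factor at most `exp r`. -/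
theorem softmax_le_of_abs_sub_le [NeZero M] {h h' : Fin M → ℝ} {r : ℝ}
    (hr : ∀ m, |h m - h' m| ≤ r) (m : Fin M) :
    softmax h m ≤ Real.exp (2 * r) * softmax h' m := by
  have hs (f : Fin M → ℝ) : 0 < ∑ i, Real.exp (f i) :=
    Finset.sum_pos (fun _ _ => Real.exp_pos _) ⟨m, Finset.mem_univ m⟩
  have h1 : Real.exp (h m) ≤ Real.exp r * Real.exp (h' m) := by
    rw [← Real.exp_add]
    exact Real.exp_le_exp.2 (by linarith [(abs_le.1 (hr m)).2])
  have h2 : ∑ i, Real.exp (h' i) ≤ Real.exp r * ∑ i, Real.exp (h i) := by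
    rw [Finset.mul_sum]
    refine Finset.sum_le_sum fun i _ => ?_
    rw [← Real.exp_add]
    exact Real.exp_le_exp.2 (by linarith [(abs_le.1 (hr i)).1])
  rw [softmax, softmax, ← mul_div_assoc, div_le_div_iff₀ (hs _) (hs _), two_mul, Real.exp_add]
  calc _ ≤ (Real.exp r * Real.exp (h' m)) * (Real.exp r * ∑ i, Real.exp (h i)) := by
        gcongr
    _ = _ := by ring

/-- Row `j` of the embedding shows token `j - 1`, and the mask keeps rows up to `d`, so token `d`
itself is never seen. -/
theorem rho_congr {φ : Fin de → ℝ} {ψ : Shared D M de L} {x x' : Fin D → Fin M} {d : Fin D}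
    (h : ∀ j < d, x j = x' j) : rho φ ψ x d = rho φ ψ x' d := by
  unfold rho
  congr 2
  funext j
  unfold mask
  split_ifs with hj
  · unfold encode embed
    split_ifs with h0
    · rfl
    · rw [h _ (Fin.lt_def.2 (by have := Fin.le_def.1 hj; simp only; omega))]
  · rfl

theorem sum_density [NeZero M] (φ : Fin de → ℝ) (ψ : Shared D M de L) :
    ∑ x, density φ ψ x = 1 :=
  sum_prod_autoregressive (fun d x => rho φ ψ x d) (fun _ _ _ h => rho_congr h)
    fun _ _ => sum_softmax _

theorem isCondPMF_of_mem_multiSpace [NeZero M] {W S : ℕ} {B : ℝ}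
    {p : (Fin D → Fin M) → Fin K → ℝ} (hp : p ∈ multiSpace D M K de L W S B) : IsCondPMF p := by
  obtain ⟨φ, ψ, -, -, h⟩ := hp
  constructor
  · intro x k
    rw [h]
    exact Finset.prod_pos fun _ _ => softmax_pos _ _
  · intro k
    simp only [h, sum_density]

theorem density_le_of_abs_eval_sub_le [NeZero M] {φ φ' : Fin de → ℝ} {ψ ψ' : Shared D M de L}
    {x : Fin D → Fin M} {r : ℝ}
    (h : ∀ d m, |ψ.net.eval (mask d (encode ψ.A0 ψ.b0 (embed φ ψ.VX x))) m -
      ψ'.net.eval (mask d (encode ψ'.A0 ψ'.b0 (embed φ' ψ'.VX x))) m| ≤ r) :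
    density φ ψ x ≤ Real.exp (D * (2 * r)) * density φ' ψ' x := by
  calc density φ ψ x ≤ ∏ d, Real.exp (2 * r) * rho φ' ψ' x d (x d) :=
        Finset.prod_le_prod (fun _ _ => (softmax_pos _ _).le)
          fun d _ => softmax_le_of_abs_sub_le (h d) _
    _ = _ := by
        rw [Finset.prod_mul_distrib, Finset.prod_const, Finset.card_univ, Fintype.card_fin,
          ← Real.exp_nat_mul, density]

theorem abs_sigmoid_sub_le (s t : ℝ) : |Real.sigmoid s - Real.sigmoid t| ≤ |s - t| := by
  have h := Convex.norm_image_sub_le_of_norm_hasDerivWithin_le (f := Real.sigmoid) (C := 1)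
    (s := Set.univ) (x := t) (y := s)
    (fun x _ => (Real.hasDerivAt_sigmoid x).hasDerivWithinAt) (fun x _ => by
      have h0 := Real.sigmoid_pos x
      have h1 := Real.sigmoid_lt_one x
      rw [Real.norm_eq_abs, abs_of_nonneg (by nlinarith)]
      nlinarith) convex_univ trivial trivial
  simpa using h

theorem abs_encode_sub_le {A A' : Matrix (Fin D) (Fin de) ℝ} {b b' : Fin D → ℝ}
    {E E' : Matrix (Fin D) (Fin de) ℝ} {B η : ℝ} (hA' : ∀ d j, |A' d j| ≤ B)
    (hE : ∀ d j, |E d j| ≤ 1) (hAA' : ∀ d j, |A d j - A' d j| ≤ η)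
    (hbb' : ∀ d, |b d - b' d| ≤ η) (hEE' : ∀ d j, |E d j - E' d j| ≤ η) (d : Fin D) :
    |encode A b E d - encode A' b' E' d| ≤ de * (η + B * η) + η := by
  refine (abs_sigmoid_sub_le _ _).trans ?_
  have h1 : A d ⬝ᵥ E d + b d - (A' d ⬝ᵥ E' d + b' d) =
      ∑ j, ((A d j - A' d j) * E d j + A' d j * (E d j - E' d j)) + (b d - b' d) := by
    have : ∀ j, (A d j - A' d j) * E d j + A' d j * (E d j - E' d j) =
        A d j * E d j - A' d j * E' d j := fun j => by ring
    simp only [this, Finset.sum_sub_distrib, dotProduct]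
    ring
  rw [h1]
  refine (abs_add_le _ _).trans (add_le_add ((Finset.abs_sum_le_sum_abs _ _).trans ?_) (hbb' d))
  calc _ ≤ ∑ _j : Fin de, (η * 1 + B * η) := by
        refine Finset.sum_le_sum fun j _ => (abs_add_le _ _).trans ?_
        rw [abs_mul, abs_mul]
        have hη : 0 ≤ η := (abs_nonneg _).trans (hbb' d)
        have hB : 0 ≤ B := (abs_nonneg _).trans (hA' d j)
        gcongr
        exacts [hAA' _ _, hE _ _, hA' _ _, hEE' _ _]
    _ = _ := by simp [mul_add]

end ARM

/-! ### Grid cells and codes of sparse networks. -/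

theorem card_finset_card_le (α : Type*) [Fintype α] [DecidableEq α] (S : ℕ) :
    Fintype.card {s : Finset α // s.card ≤ S} ≤ (Fintype.card α + 1) ^ S := by
  have hcard (f : Fin S → Option α) : (Finset.univ.image f).eraseNone.card ≤ S := by
    exact (Finset.card_eraseNone_le _).trans (Finset.card_image_le.trans (by simp))
  have hsurj : Function.Surjective fun f : Fin S → Option α =>
      (⟨(Finset.univ.image f).eraseNone, hcard f⟩ : {s : Finset α // s.card ≤ S}) := by
    rintro ⟨s, hs⟩
    -- The elements of `s` fill the first slots; the out-of-range lookups give `none`, which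
    -- `eraseNone` discards.
    refine ⟨fun i => s.toList[(i : ℕ)]?, Subtype.ext ?_⟩
    ext a
    simp only [Finset.mem_eraseNone, Finset.mem_image, Finset.mem_univ, true_and]
    rw [← Finset.mem_toList, List.mem_iff_getElem?]
    constructor
    · rintro ⟨i, hi⟩
      exact ⟨i, hi⟩
    · rintro ⟨i, hi⟩
      obtain ⟨hlt, -⟩ := List.getElem?_eq_some_iff.1 hi
      rw [Finset.length_toList] at hlt
      exact ⟨⟨i, hlt.trans_le hs⟩, hi⟩
  simpa using Fintype.card_le_of_surjective _ hsurj

/-- The index of the cell of width `η` of the interval `[-B, B]` that contains `t`. -/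
noncomputable def gridCell (B η : ℝ) (G : ℕ) (t : ℝ) : Fin (G + 1) :=
  ⟨min ⌊(t + B) / η⌋₊ G, Nat.lt_succ_of_le (min_le_right _ _)⟩

theorem abs_sub_le_of_gridCell_eq {B η : ℝ} {G : ℕ} {t t' : ℝ} (hη : 0 < η)
    (hG : 2 * B / η ≤ G) (ht : |t| ≤ B) (ht' : |t'| ≤ B)
    (h : gridCell B η G t = gridCell B η G t') : |t - t'| ≤ η := by
  -- The cap `G` only makes the index finite; it is inactive on `[-B, B]`.
  have key (u : ℝ) (hu : |u| ≤ B) : min ⌊(u + B) / η⌋₊ G = ⌊(u + B) / η⌋₊ := by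
    refine min_eq_left (Nat.floor_le_of_le (le_trans ?_ hG))
    gcongr
    linarith [(abs_le.1 hu).2]
  have h' := congrArg Fin.val h
  simp only [gridCell, key t ht, key t' ht'] at h'
  have hnn (u : ℝ) (hu : |u| ≤ B) : 0 ≤ (u + B) / η :=
    div_nonneg (by linarith [(abs_le.1 hu).1]) hη.le
  have a1 := Nat.floor_le (hnn t ht)
  have a2 := Nat.lt_floor_add_one ((t + B) / η)
  have b1 := Nat.floor_le (hnn t' ht')
  have b2 := Nat.lt_floor_add_one ((t' + B) / η)
  rw [h'] at a1 a2
  have h3 : |(t + B) / η - (t' + B) / η| ≤ 1 := by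
    rw [abs_le]; constructor <;> linarith
  rw [← sub_div, abs_div, abs_of_pos hη, div_le_one hη] at h3
  simpa using h3

namespace MLP

theorem pad_eq_zero {W R : ℕ} (hW : W ≤ R) : {l a c : ℕ} → (N : MLP l a c) → N.WidthLE W →
    a ≤ R → {k i j : ℕ} → (l ≤ k ∨ W ≤ i ∨ R < j) → N.pad k i j = 0
  | _, _, _, affine A b, hN, ha, k, i, j, h => by
    rw [pad]
    split_ifs with hk
    · exact padLayer_eq_zero hN ha (h.resolve_left (by omega))
    · rfl
  | l + 1, _, _, snoc N A b, hN, ha, k, i, j, h => by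
    rw [pad]
    split_ifs with hk
    · exact padLayer_eq_zero hN.2 (hN.1.out_le.trans hW) (h.resolve_left (by omega))
    · exact pad_eq_zero hW N hN.1 ha (h.imp_left fun h => by omega)

/-- The positions of the nonzero weights of a network with the grid cells of their values. -/
noncomputable def sparseCode (L W R : ℕ) (B η : ℝ) (G : ℕ) (θ : ℕ → ℕ → ℕ → ℝ) :
    Finset ((Fin L × Fin W × Fin (R + 1)) × Fin (G + 1)) :=
  open Classical in
  (Finset.univ.filter fun p : Fin L × Fin W × Fin (R + 1) => θ p.1 p.2.1 p.2.2 ≠ 0).image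
    fun p => (p, gridCell B η G (θ p.1 p.2.1 p.2.2))

theorem card_sparseCode_le {L a c W R S : ℕ} {B η : ℝ} {G : ℕ} {N : MLP L a c}
    (hN : N.nnz ≤ S) : (sparseCode L W R B η G N.pad).card ≤ S := by
  classical
  refine Finset.card_image_le.trans ?_
  have hinj : Function.Injective fun p : Fin L × Fin W × Fin (R + 1) =>
      ((p.1 : ℕ), (p.2.1 : ℕ), (p.2.2 : ℕ)) := by
    rintro ⟨a, b, c⟩ ⟨a', b', c'⟩ h
    simp only [Prod.mk.injEq] at h
    exact Prod.ext (Fin.ext h.1) (Prod.ext (Fin.ext h.2.1) (Fin.ext h.2.2))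
  have h := encard_pad_le N
  rw [← Nat.cast_le (α := ℕ∞), ← Set.encard_coe_eq_coe_finsetCard, ← hinj.encard_image]
  refine le_trans (Set.encard_le_encard ?_) (h.trans (Nat.cast_le.2 hN))
  rintro _ ⟨p, hp, rfl⟩
  simpa using hp

/-- Equal codes force equal supports within the array. An entry nonzero in one network puts its
position and cell into the common code, so the other network has the same cell there; all other
entries vanish in both. -/
theorem abs_pad_sub_le_of_sparseCode_eq {L a c W R : ℕ} {B η : ℝ} {G : ℕ} {N N' : MLP L a c}
    (hB : 0 ≤ B) (hη : 0 < η) (hG : 2 * B / η ≤ G) (hW : W ≤ R) (ha : a ≤ R)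
    (hN : N.WidthLE W) (hN' : N'.WidthLE W) (hE : N.EntriesLE B) (hE' : N'.EntriesLE B)
    (h : sparseCode L W R B η G N.pad = sparseCode L W R B η G N'.pad) (k i j : ℕ) :
    |N.pad k i j - N'.pad k i j| ≤ η := by
  classical
  by_cases hr : L ≤ k ∨ W ≤ i ∨ R < j
  · rw [pad_eq_zero hW N hN ha hr, pad_eq_zero hW N' hN' ha hr]
    simpa using hη.le
  push Not at hr
  have key (N N' : MLP L a c)
      (h : sparseCode L W R B η G N.pad = sparseCode L W R B η G N'.pad)
      (h0 : N.pad k i j ≠ 0) :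
      gridCell B η G (N'.pad k i j) = gridCell B η G (N.pad k i j) := by
    have hm : (((⟨k, hr.1⟩, ⟨i, hr.2.1⟩, ⟨j, Nat.lt_succ_of_le hr.2.2⟩) :
        Fin L × Fin W × Fin (R + 1)), gridCell B η G (N.pad k i j)) ∈
        sparseCode L W R B η G N.pad := by
      refine Finset.mem_image.2 ⟨(⟨k, hr.1⟩, ⟨i, hr.2.1⟩, ⟨j, Nat.lt_succ_of_le hr.2.2⟩), ?_, rfl⟩
      simpa using h0
    rw [h] at hm
    obtain ⟨p, -, hp⟩ := Finset.mem_image.1 hm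
    rw [Prod.mk.injEq] at hp
    obtain ⟨rfl, hp⟩ := hp
    exact hp
  have hθ := hE.abs_pad_le hB k i j
  have hθ' := hE'.abs_pad_le hB k i j
  by_cases h0 : N.pad k i j = 0
  · by_cases h0' : N'.pad k i j = 0
    · rw [h0, h0']
      simpa using hη.le
    · exact abs_sub_le_of_gridCell_eq hη hG hθ hθ' (key N' N h.symm h0')
  · exact abs_sub_le_of_gridCell_eq hη hG hθ hθ' (key N N' h h0).symm

theorem EntriesLE.mono {B B' : ℝ} (hB : B ≤ B') : {l a c : ℕ} → {N : MLP l a c} →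
    N.EntriesLE B → N.EntriesLE B'
  | _, _, _, affine _ _, h => ⟨fun i j => (h.1 i j).trans hB, fun i => (h.2 i).trans hB⟩
  | _, _, _, snoc _ _ _, h =>
    ⟨h.1.mono hB, fun i j => (h.2.1 i j).trans hB, fun i => (h.2.2 i).trans hB⟩

end MLP

/-! ### Codes of multi-source models: resolution and number. -/

namespace ARM

variable {D M K de L W S : ℕ} {B : ℝ}

theorem encode_mem_Icc (A : Matrix (Fin D) (Fin de) ℝ) (b : Fin D → ℝ)
    (E : Matrix (Fin D) (Fin de) ℝ) (d : Fin D) : encode A b E d ∈ Set.Icc (0 : ℝ) 1 :=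
  ⟨Real.sigmoid_nonneg _, Real.sigmoid_le_one _⟩

theorem mask_mem_Icc {v : Fin D → ℝ} (hv : ∀ d, v d ∈ Set.Icc (0 : ℝ) 1) (d j : Fin D) :
    mask d v j ∈ Set.Icc (0 : ℝ) 1 := by
  rw [mask]
  split_ifs
  exacts [hv j, by simp]

theorem abs_mask_sub_le {v v' : Fin D → ℝ} {ε : ℝ} (hε : 0 ≤ ε) (h : ∀ d, |v d - v' d| ≤ ε)
    (d j : Fin D) : |mask d v j - mask d v' j| ≤ ε := by
  rw [mask, mask]
  split_ifs
  exacts [h j, by simpa]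

/-- The grid cells of all parameters of a multi-source model. -/
abbrev Code (D M K de L W S R G : ℕ) : Type :=
  (Fin K → Fin de → Fin (G + 1)) × (Fin M → Fin de → Fin (G + 1)) ×
    (Fin D → Fin de → Fin (G + 1)) × (Fin D → Fin (G + 1)) ×
    {s : Finset ((Fin L × Fin W × Fin (R + 1)) × Fin (G + 1)) // s.card ≤ S}

theorem card_code_le (D M K de L W S R G : ℕ) : Fintype.card (Code D M K de L W S R G) ≤
    (G + 1) ^ (D + (D + M + K) * de) * (L * (W * (R + 1)) * (G + 1) + 1) ^ S := by
  have h := card_finset_card_le ((Fin L × Fin W × Fin (R + 1)) × Fin (G + 1)) S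
  simp only [Fintype.card_prod, Fintype.card_fin] at h
  simp only [Fintype.card_prod, Fintype.card_fun, Fintype.card_fin]
  refine (Nat.mul_le_mul_left _ (Nat.mul_le_mul_left _ (Nat.mul_le_mul_left _
    (Nat.mul_le_mul_left _ h)))).trans (le_of_eq ?_)
  ring

/-- `p` is the conditional mass function of parameters with the given grid cells. -/
def HasCode (b η : ℝ) (W S : ℕ) (B : ℝ) {R G : ℕ} (L de : ℕ)
    (p : (Fin D → Fin M) → Fin K → ℝ) (c : Code D M K de L W S R G) : Prop :=
  ∃ φ : Fin K → Fin de → ℝ, ∃ ψ : Shared D M de L,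
    (∀ k, φ k ∈ sourceSpace de) ∧ ψ ∈ sharedSpace D M de L W S B ∧
      (∀ x k, p x k = density (φ k) ψ x) ∧
      (∀ k j, gridCell b η G (φ k j) = c.1 k j) ∧
      (∀ m j, gridCell b η G (ψ.VX m j) = c.2.1 m j) ∧
      (∀ d j, gridCell b η G (ψ.A0 d j) = c.2.2.1 d j) ∧
      (∀ d, gridCell b η G (ψ.b0 d) = c.2.2.2.1 d) ∧
      MLP.sparseCode L W R b η G ψ.net.pad = c.2.2.2.2

theorem exists_hasCode (b η : ℝ) (R G : ℕ) {p : (Fin D → Fin M) → Fin K → ℝ}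
    (hp : p ∈ multiSpace D M K de L W S B) :
    ∃ c : Code D M K de L W S R G, HasCode b η W S B L de p c := by
  obtain ⟨φ, ψ, hφ, hψ, h⟩ := hp
  exact ⟨(fun k j => gridCell b η G (φ k j), fun m j => gridCell b η G (ψ.VX m j),
    fun d j => gridCell b η G (ψ.A0 d j), fun d => gridCell b η G (ψ.b0 d),
    ⟨MLP.sparseCode L W R b η G ψ.net.pad, MLP.card_sparseCode_le hψ.2.2.2.2.1⟩),
    φ, ψ, hφ, hψ, h, fun _ _ => rfl, fun _ _ => rfl, fun _ _ => rfl, fun _ => rfl, rfl⟩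

theorem abs_le_of_mem_Icc_zero_one {t b : ℝ} (hb : 1 ≤ b) (h : t ∈ Set.Icc (0 : ℝ) 1) :
    |t| ≤ b :=
  (abs_of_nonneg h.1).trans_le (h.2.trans hb)

/-- The rounding error `η` passes through the sigmoid encoding, where it becomes `de * (η + b * η) +
η`, then through the network, then through `D` softmax factors. -/
theorem HasCode.le_exp_mul [NeZero M] {b η : ℝ} {R G : ℕ} {p q : (Fin D → Fin M) → Fin K → ℝ}
    {c : Code D M K de L W S R G} (hb : 1 ≤ b) (hBb : B ≤ b) (hη : 0 < η)
    (hG : 2 * b / η ≤ G) (hW : W ≤ R) (hD : D ≤ R)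
    (hp : HasCode b η W S B L de p c) (hq : HasCode b η W S B L de q c)
    (x : Fin D → Fin M) (k : Fin K) :
    p x k ≤ Real.exp (D * (2 * ((b * (R + 1)) ^ L *
      ((de * (η + b * η) + η) + L * (η * (R + 1)))))) * q x k := by
  obtain ⟨φ, ψ, hφ, ⟨hV, hA, hb0, hNW, -, hNE⟩, h, c1, c2, c3, c4, c5⟩ := hp
  obtain ⟨φ', ψ', hφ', ⟨hV', hA', hb0', hNW', -, hNE'⟩, h', c1', c2', c3', c4', c5'⟩ := hq
  rw [h, h']
  have hb0le : 0 ≤ b := zero_le_one.trans hb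
  have hE := hNE.mono hBb
  have hE' := hNE'.mono hBb
  have hAb {t : ℝ} (ht : t ∈ Set.Icc (-B) B) : |t| ≤ b := (abs_le.2 ht).trans hBb
  have hembed (j : Fin D) (i : Fin de) :
      |embed (φ k) ψ.VX x j i - embed (φ' k) ψ'.VX x j i| ≤ η := by
    unfold embed
    split_ifs
    · exact abs_sub_le_of_gridCell_eq hη hG (abs_le_of_mem_Icc_zero_one hb (hφ k i))
        (abs_le_of_mem_Icc_zero_one hb (hφ' k i)) ((c1 k i).trans (c1' k i).symm)
    · exact abs_sub_le_of_gridCell_eq hη hG (abs_le_of_mem_Icc_zero_one hb (hV _ i))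
        (abs_le_of_mem_Icc_zero_one hb (hV' _ i)) ((c2 _ i).trans (c2' _ i).symm)
  have hembed1 (j : Fin D) (i : Fin de) : |embed (φ k) ψ.VX x j i| ≤ 1 := by
    unfold embed
    split_ifs
    · exact abs_le_of_mem_Icc_zero_one le_rfl (hφ k i)
    · exact abs_le_of_mem_Icc_zero_one le_rfl (hV _ i)
  have henc := abs_encode_sub_le (fun d j => hAb (hA' d j)) hembed1
    (fun d j => abs_sub_le_of_gridCell_eq hη hG (hAb (hA d j)) (hAb (hA' d j))
      ((c3 d j).trans (c3' d j).symm))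
    (fun d => abs_sub_le_of_gridCell_eq hη hG (hAb (hb0 d)) (hAb (hb0' d))
      ((c4 d).trans (c4' d).symm)) hembed
  have hε : 0 ≤ de * (η + b * η) + η := by positivity
  refine density_le_of_abs_eval_sub_le fun d m => ?_
  have hm := mask_mem_Icc (encode_mem_Icc ψ.A0 ψ.b0 (embed (φ k) ψ.VX x)) d
  have hm' := mask_mem_Icc (encode_mem_Icc ψ'.A0 ψ'.b0 (embed (φ' k) ψ'.VX x)) d
  rw [MLP.eval_eq_forward hW _ hNW hD _ fun j => (hm j).1,
    MLP.eval_eq_forward hW _ hNW' hD _ fun j => (hm' j).1]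
  refine MLP.forward_lipschitz hb hη.le hε (hE.abs_pad_le hb0le) (hE'.abs_pad_le hb0le)
    (MLP.abs_pad_sub_le_of_sparseCode_eq hb0le hη hG hW hD hNW hNW' hE hE' (c5.trans c5'.symm))
    (fun i => ?_) (fun i => ?_) L m
  · split_ifs
    · exact abs_le_of_mem_Icc_zero_one le_rfl (hm _)
    · simp
  · split_ifs
    · exact abs_mask_sub_le hε henc d _
    · simpa using hε

/-- The exponent `2 * L + 4` is a budget: `2 * L` for the amplification through the layers, 3 for
the encoding and weight errors, 1 for `2 * n * D`. -/
theorem logit_error_le {n D de L W : ℕ} {b Λ : ℝ} (hn : 1 ≤ n) (hD : 1 ≤ D) (hde : 1 ≤ de)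
    (hL : 1 ≤ L) (hW : 1 ≤ W) (hb : 1 ≤ b)
    (hΛ : Λ = (n : ℝ) * D * de * L * ((W : ℝ) + 1) * b) :
    2 ≤ Λ ∧ 2 * b ≤ Λ ∧ (L : ℝ) * W ≤ Λ ∧ (((W + D : ℕ) : ℝ) + 1) ≤ Λ ^ 2 ∧
    D * (2 * ((b * (((W + D : ℕ) : ℝ) + 1)) ^ L *
      ((de * ((Λ ^ (2 * L + 4))⁻¹ + b * (Λ ^ (2 * L + 4))⁻¹) + (Λ ^ (2 * L + 4))⁻¹) +
        L * ((Λ ^ (2 * L + 4))⁻¹ * (((W + D : ℕ) : ℝ) + 1))))) ≤ 1 / (n : ℝ) := by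
  have hn' : (1 : ℝ) ≤ n := by exact_mod_cast hn
  have hD' : (1 : ℝ) ≤ D := by exact_mod_cast hD
  have hde' : (1 : ℝ) ≤ de := by exact_mod_cast hde
  have hL' : (1 : ℝ) ≤ L := by exact_mod_cast hL
  have hW' : (1 : ℝ) ≤ W := by exact_mod_cast hW
  have hW2 : (2 : ℝ) ≤ (W : ℝ) + 1 := by linarith
  have hW1 : (1 : ℝ) ≤ (W : ℝ) + 1 := by linarith
  have hWW : (W : ℝ) ≤ (W : ℝ) + 1 := by linarith
  -- Each of these bounds comes from lowering some factors of `Λ` to 1, or `W + 1` to 2 or `W`.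
  have k1 : (1 : ℝ) * 1 * 1 * 1 * 2 * b ≤ Λ := by rw [hΛ]; gcongr
  have k2 : (1 : ℝ) * 1 * 1 * L * W * 1 ≤ Λ := by rw [hΛ]; gcongr
  have k3 : (1 : ℝ) * D * 1 * 1 * ((W : ℝ) + 1) * b ≤ Λ := by rw [hΛ]; gcongr
  have k4 : (1 : ℝ) * D * 1 * L * ((W : ℝ) + 1) * 1 ≤ Λ := by rw [hΛ]; gcongr
  have k5 : (1 : ℝ) * 1 * de * 1 * 2 * b ≤ Λ := by rw [hΛ]; gcongr
  have k6 : (n : ℝ) * D * 1 * 1 * 2 * 1 ≤ Λ := by rw [hΛ]; gcongr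
  have h2 : 2 ≤ Λ := by linarith
  have hΛ0 : 0 < Λ := by linarith
  set r : ℝ := ((W + D : ℕ) : ℝ) + 1 with hr
  have hr0 : 0 ≤ r := by positivity
  have hr2 : r ≤ 2 * (D * ((W : ℝ) + 1)) := by
    rw [hr]
    push_cast
    nlinarith
  have hbr : b * r ≤ Λ ^ 2 := by nlinarith
  have hr3 : r ≤ Λ ^ 2 := by nlinarith
  have hLr : L * r ≤ Λ ^ 2 := by nlinarith
  have hdeb : de * (1 + b) + 1 ≤ Λ ^ 2 := by nlinarith
  refine ⟨h2, by linarith, by linarith, hr3, ?_⟩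
  set η := (Λ ^ (2 * L + 4))⁻¹ with hη
  have hη0 : 0 < η := by positivity
  have hpow : (b * r) ^ L ≤ Λ ^ (2 * L) := by
    rw [pow_mul]
    exact pow_le_pow_left₀ (by positivity) hbr L
  have hsum : (de * (η + b * η) + η) + L * (η * r) ≤ Λ ^ 3 * η := by
    have : (de * (η + b * η) + η) + L * (η * r) = (de * (1 + b) + 1 + L * r) * η := by ring
    rw [this]
    refine mul_le_mul_of_nonneg_right ?_ hη0.le
    nlinarith [sq_nonneg Λ]
  rw [le_div_iff₀ (by linarith)]
  calc _ = (n * D * 2) * ((b * r) ^ L * ((de * (η + b * η) + η) + L * (η * r))) := by ring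
    _ ≤ Λ * (Λ ^ (2 * L) * (Λ ^ 3 * η)) := by
        gcongr
        linarith
    _ = Λ ^ (2 * L + 4) * η := by ring
    _ = 1 := mul_inv_cancel₀ (by positivity)

theorem card_code_le_exp {D M K de L W S G : ℕ} {b Λ : ℝ} (hL : 1 ≤ L) (h2 : 2 ≤ Λ)
    (hbΛ : 2 * b ≤ Λ) (hLW : (L : ℝ) * W ≤ Λ) (hR : ((W + D : ℕ) : ℝ) + 1 ≤ Λ ^ 2)
    (hG : (G : ℝ) ≤ 2 * b * Λ ^ (2 * L + 4) + 1) :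
    (Fintype.card (Code D M K de L W S (W + D) G) : ℝ) ≤
      Real.exp (12 * ((L : ℝ) * ((S : ℝ) + D + ((D : ℝ) + M + K) * de) * Real.log Λ)) := by
  have hΛ0 : 0 < Λ := by linarith
  have h1 : 1 ≤ Λ := by linarith
  -- Since `Λ ≥ 2`, additive constants are absorbed by one more power of `Λ`.
  have hstep (k : ℕ) : Λ ^ (k + 1) + 2 ≤ Λ ^ (k + 2) := by
    have : 1 ≤ Λ ^ k := one_le_pow₀ h1
    have e1 : Λ ^ (k + 1) = Λ ^ k * Λ := pow_succ _ _
    have e2 : Λ ^ (k + 2) = Λ ^ k * Λ * Λ := by rw [pow_succ, pow_succ]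
    rw [e1, e2]
    nlinarith [mul_le_mul this h2 (by norm_num) (by linarith)]
  have hG1 : (G : ℝ) + 1 ≤ Λ ^ (2 * L + 6) := by
    refine le_trans ?_ (hstep (2 * L + 4))
    have : 2 * b * Λ ^ (2 * L + 4) ≤ Λ ^ (2 * L + 4 + 1) := by
      calc _ ≤ Λ * Λ ^ (2 * L + 4) := by gcongr
        _ = _ := by ring
    linarith
  have hQ : (L : ℝ) * (W * (((W + D : ℕ) : ℝ) + 1)) * (G + 1) + 1 ≤ Λ ^ (2 * L + 10) := by
    refine le_trans ?_ (hstep (2 * L + 8))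
    have : (L : ℝ) * (W * (((W + D : ℕ) : ℝ) + 1)) * (G + 1) ≤ Λ ^ (2 * L + 8 + 1) := by
      calc _ = (L : ℝ) * W * (((W + D : ℕ) : ℝ) + 1) * (G + 1) := by ring
        _ ≤ Λ * Λ ^ 2 * Λ ^ (2 * L + 6) := by gcongr
        _ = _ := by ring
    linarith
  -- The constant 12 is what makes `2 * L + 10 ≤ 12 * L` for all `L ≥ 1`.
  have hGL : (G : ℝ) + 1 ≤ Λ ^ (12 * L) := hG1.trans (pow_le_pow_right₀ h1 (by omega))
  have hQL := hQ.trans (pow_le_pow_right₀ h1 (show 2 * L + 10 ≤ 12 * L by omega))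
  have hc : (Fintype.card (Code D M K de L W S (W + D) G) : ℝ) ≤
      ((G : ℝ) + 1) ^ (D + (D + M + K) * de) *
        ((L : ℝ) * (W * (((W + D : ℕ) : ℝ) + 1)) * (G + 1) + 1) ^ S := by
    exact_mod_cast card_code_le D M K de L W S (W + D) G
  calc _ ≤ _ := hc
    _ ≤ (Λ ^ (12 * L)) ^ (D + (D + M + K) * de) * (Λ ^ (12 * L)) ^ S := by gcongr
    _ = Λ ^ (12 * (L * (S + D + (D + M + K) * de))) := by
        rw [← pow_add, ← pow_mul]
        ring
    _ = _ := by
        rw [← Real.exp_log (pow_pos hΛ0 _), Real.log_pow]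
        push_cast
        ring_nf

end ARM

/-! ### Choice of constants. -/

theorem theorem3 :
    ∃ C : ℝ, 0 < C ∧
      ∀ (D M K de L W S n : ℕ) (B δ : ℝ),
        1 ≤ D → 1 ≤ M → 1 ≤ K → 1 ≤ de → 1 ≤ L → 1 ≤ W → 1 ≤ S → 1 ≤ n → 0 < B →
        0 < δ → δ ≤ 1 / 2 →
        ∀ (pY : PMF (Fin K)) (pstar : (Fin D → Fin M) → Fin K → ℝ),
          pstar ∈ ARM.multiSpace D M K de L W S B →
          ENNReal.ofReal (1 - δ) ≤
            (MeasureTheory.Measure.pi fun _ : Fin n => ARM.jointLaw pY pstar)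
              {s | ∀ phat : (Fin D → Fin M) → Fin K → ℝ,
                ARM.IsMLE (ARM.multiSpace D M K de L W S B) s phat →
                ARM.avgTV pY phat pstar ≤
                  C * Real.sqrt
                    (((L : ℝ) * ((S : ℝ) + D + ((D : ℝ) + M + K) * de) *
                        Real.log ((n : ℝ) * D * de * L * ((W : ℝ) + 1) * max B 1) +
                      Real.log (1 / δ)) / n)} := by
  -- `7 = 5 + 2`: 5 from the deviation `t`, 2 from the rounding error `1 / n`.
  refine ⟨7, by norm_num, ?_⟩
  intro D M K de L W S n B δ hD hM _ hde hL hW _ hn _ hδ hδ2 pY pstar hstar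
  have : NeZero M := ⟨by omega⟩
  -- A bound of at least 1 lets one grid on `[-b, b]` serve the embeddings in `[0, 1]` too, and is
  -- needed for the growth estimate.
  have hb : 1 ≤ max B 1 := le_max_right _ _
  have hBb : B ≤ max B 1 := le_max_left _ _
  set b := max B 1
  set Λ := (n : ℝ) * D * de * L * ((W : ℝ) + 1) * b with hΛ
  obtain ⟨h2, hbΛ, hLW, hR, herr⟩ := ARM.logit_error_le hn hD hde hL hW hb hΛ
  have hn' : (1 : ℝ) ≤ n := by exact_mod_cast hn
  have hn0 : (0 : ℝ) < n := by linarith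
  have hη0 : 0 < (Λ ^ (2 * L + 4))⁻¹ := by positivity
  set Y := (L : ℝ) * ((S : ℝ) + D + ((D : ℝ) + M + K) * de) * Real.log Λ with hY
  have hY0 : 0 ≤ Y := mul_nonneg (by positivity) (Real.log_nonneg (by linarith))
  -- This pays for the `1 / 2` in the tail exponent and gives `X ≥ 1 / 2`, which makes `1 / n` of
  -- lower order than the main term.
  have hlogδ : 1 / 2 ≤ Real.log (1 / δ) := by
    have h3 : (2 : ℝ) ≤ 1 / δ := by rw [le_div_iff₀ hδ]; linarith
    linarith [Real.log_le_log (by norm_num) h3, Real.log_two_gt_d9]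
  set X := Y + Real.log (1 / δ) with hX
  set G := ⌈2 * b / (Λ ^ (2 * L + 4))⁻¹⌉₊ with hGdef
  have hG : 2 * b / (Λ ^ (2 * L + 4))⁻¹ ≤ G := Nat.le_ceil _
  have hG' : (G : ℝ) ≤ 2 * b * Λ ^ (2 * L + 4) + 1 := by
    have := (Nat.ceil_lt_add_one (show 0 ≤ 2 * b / (Λ ^ (2 * L + 4))⁻¹ by positivity)).le
    rwa [← hGdef, div_inv_eq_mul] at this
  have hcard := ARM.card_code_le_exp (D := D) (M := M) (K := K) (de := de) (S := S) hL h2 hbΛ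
    hLW hR hG'
  rw [← hY] at hcard
  have hXn : 0 ≤ X / n := div_nonneg (by linarith) hn0.le
  have hmain := ARM.IsCondPMF.mle_avgTV_le (P := ARM.multiSpace D M K de L W S B)
    (fun p hp => ARM.isCondPMF_of_mem_multiSpace hp)
    (J := ARM.Code D M K de L W S (W + D) G)
    (ARM.HasCode b (Λ ^ (2 * L + 4))⁻¹ W S B L de) (fun p hp => ARM.exists_hasCode _ _ _ _ hp) hn
    (fun p hp q hq c hpc hqc x k => (hpc.le_exp_mul hb hBb hη0 hG (Nat.le_add_right _ _)
      (Nat.le_add_left _ _) hqc x k).trans (mul_le_mul_of_nonneg_right (Real.exp_le_exp.2 herr)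
        ((ARM.isCondPMF_of_mem_multiSpace hq).pos x k).le))
    pY hstar (t := 5 * √(X / n)) (δ := δ) (by positivity) (by
      -- The factor 5 is chosen so that `25 / 2` exceeds the 12 in the cardinality bound.
      have ht : n * (5 * √(X / n)) ^ 2 / 2 = 25 / 2 * X := by
        rw [mul_pow, Real.sq_sqrt hXn]
        field_simp
        ring
      rw [ht]
      calc _ ≤ Real.exp (12 * Y) * Real.exp (1 / 2 - 25 / 2 * X) := by gcongr
        _ ≤ Real.exp (-Real.log (1 / δ)) := by
            rw [← Real.exp_add]
            exact Real.exp_le_exp.2 (by linarith)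
        _ = δ := by rw [one_div, Real.log_inv, neg_neg, Real.exp_log hδ])
  refine hmain.trans (measure_mono fun s hs phat hmle => (hs phat hmle).trans ?_)
  have hinv : 1 / (n : ℝ) ≤ 2 * √(X / n) := by
    have h4 : 1 / (2 * (n : ℝ)) ≤ √(X / n) := by
      refine Real.le_sqrt_of_sq_le ?_
      rw [div_pow, div_le_div_iff₀ (by positivity) hn0]
      nlinarith
    calc 1 / (n : ℝ) = 2 * (1 / (2 * n)) := by field_simp
      _ ≤ _ := by gcongr
  linarith
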